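/- **Networks.** Fix a set $\mathcal A$ of measurable activation functions $\mathbb R\to\mathbb R$ containing ReLU, $t\mapsto\max(t,0)$. A *$k$-layer network* is a layered feed-forward network with $k$ layers of gates and arbitrary connections between consecutive layers (the first layer reads the input). Each gate applies an activation function to an affine function of the gates it is connected to in the previous layer. Hidden layers are non-empty and their gates use activations from $\mathcal A$; all gates of the last layer use ReLU. The number of parameters is the number of connections (weights) plus the number of gates (biases). **Setting.** Let $k\ge 2$ and let $\mathcal D_{real}$ be a probability distribution on $\mathbb R^d$. - The measuring function $\phi:[0,1]\to[-\Delta,\Delta]$ is concave and $L_\phi$-Lipschitz. - The generators $G_u:\mathbb R^\ell\to\mathbb R^d$ ($u\in\mathcal U$) and the discriminators $D_v:\mathbb R^d\to[0,1]$ ($v\in\mathcal V$) are $k$-layer networks with at most $p$ parameters, and $\mathcal U,\mathcal V$ are subsets of the unit ball of $\mathbb R^p$. - Generators and discriminators are $L$-Lipschitz in their parameters, $\|G_u(h)-G_{u'}(h)\|\le L\|u-u'\|$ and $|D_v(x)-D_{v'}(x)|\le L\|v-v'\|$ for all $h,x$, and $L'$-Lipschitz in their inputs. - The generators approximate point masses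 at the points of the real distribution: for $\mathcal D_{real}$-almost every $x$ and every $\eta>0$ there is $u\in\mathcal U$ with $\mathbb E_{h\sim N(0,I_\ell)}\|G_u(h)-x\|\le\eta$. For a generator $G:\mathbb R^n\to\mathbb R^d$ and a discriminator $D:\mathbb R^d\to[0,1]$ let $$F(G,D)=\mathbb E_{x\sim\mathcal D_{real}}[\phi(D(x))]+\mathbb E_{h\sim N(0,I_n)}[\phi(1-D(G(h)))].$$ For a class $\mathcal G$ of generators and a class $\mathcal D$ of discriminators, $(G,D)\in\mathcal G\times\mathcal D$ is an *$\epsilon$-approximate pure equilibrium with value $V$* if $F(G,D')\le V+\epsilon$ for all $D'\in\mathcal D$ and $F(G',D)\ge V-\epsilon$ for all $G'\in\mathcal G$. **Theorem.** There is a universal constant $C>0$ such that, in this setting, for every $\epsilon$ with $0<\epsilon\le 4\Delta$, if $L'\ge 1$ and $LL'L_\phi p/\epsilon\ge 2$, there is an integer $$N\le C\,\frac{\Delta^2p^2\log(LL'L_\phi p/\epsilon)}{\epsilon^2}$$ with the following properties. Let $\mathcal G_N$ be the class of all $(k+1)$-layer generator networks $\mathbb R^{\ell+1}\to\mathbb R^d$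 with at most $N$ parameters; their input is $N(0,I_{\ell+1})$, that is, they have one extra Gaussian input. Every $G_u$, with the extra input ignored, belongs to $\mathcal G_N$, and every $D_v$ is also a $(k+1)$-layer network with at most $N$ parameters. There are $G\in\mathcal G_N$ and a $(k+1)$-layer discriminator network $D:\mathbb R^d\to[0,1]$ with at most $N$ parameters such that $(G,D)$ is an $\epsilon$-approximate pure equilibrium with value $2\phi(1/2)$ of the game in which the generator is chosen from $\mathcal G_N$ and the discriminator from $\{D_v:v\in\mathcal V\}\cup\{D\}$. -/

import Mathlib

open MeasureTheory ProbabilityTheory Set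

namespace GAN

/-- The rectified linear unit. -/
noncomputable def relu (t : ℝ) : ℝ := max t 0

/-- The affine part of one layer, with `n` inputs and `m` gates: a set of connections
(`(j, i) ∈ edges` means that input `i` is wired to gate `j`), a weight on each connection,
and a bias at each gate. Weights off the connection set are never used. -/
structure AffineLayer (n m : ℕ) where
  edges : Finset (Fin m × Fin n)
  weight : Fin m → Fin n → ℝ
  bias : Fin m → ℝ

/-- The number of parameters of a layer: one weight for each connection, one bias for each gate. -/
def AffineLayer.numParams {n m : ℕ} (A : AffineLayer n m) : ℕ := A.edges.card + m

/-- The values that enter the activation functions of the gates. -/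
noncomputable def AffineLayer.preact {n m : ℕ} (A : AffineLayer n m) (x : Fin n → ℝ) :
    Fin m → ℝ :=
  fun j => (∑ i : Fin n, if (j, i) ∈ A.edges then A.weight j i * x i else 0) + A.bias j

/-- `Net 𝒜 k n m`: feed-forward neural networks with `k` layers of gates, `n` inputs and `m`
outputs. A gate in a hidden layer applies an activation function from `𝒜`; every gate in the last
layer applies ReLU. Hidden layers have at least one gate. -/
inductive Net (𝒜 : Set (ℝ → ℝ)) : ℕ → ℕ → ℕ → Type
  | output {n m : ℕ} (A : AffineLayer n m) : Net 𝒜 1 n m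
  | hidden {k n w m : ℕ} (A : AffineLayer n w) (hw : 0 < w) (σ : Fin w → 𝒜)
      (rest : Net 𝒜 k w m) : Net 𝒜 (k + 1) n m

/-- The function computed by a network. -/
noncomputable def Net.eval {𝒜 : Set (ℝ → ℝ)} :
    {k n m : ℕ} → Net 𝒜 k n m → (Fin n → ℝ) → Fin m → ℝ
  | _, _, _, .output A => fun x j => relu (A.preact x j)
  | _, _, _, .hidden A _ σ rest => fun x => rest.eval (fun j => (σ j : ℝ → ℝ) (A.preact x j))

/-- The number of parameters of a network. -/
def Net.numParams {𝒜 : Set (ℝ → ℝ)} : {k n m : ℕ} → Net 𝒜 k n m → ℕ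
  | _, _, _, .output A => A.numParams
  | _, _, _, .hidden A _ _ rest => A.numParams + rest.numParams

/-- The generators `ℝⁿ → ℝᵈ` that are `k`-layer networks with at most `N` parameters. -/
def generatorNets (𝒜 : Set (ℝ → ℝ)) (k N n d : ℕ) :
    Set (EuclideanSpace ℝ (Fin n) → EuclideanSpace ℝ (Fin d)) :=
  {G | ∃ 𝒩 : Net 𝒜 k n d, 𝒩.numParams ≤ N ∧ ∀ h, G h = WithLp.toLp 2 (𝒩.eval (WithLp.ofLp h))}

/-- The discriminators `ℝᵈ → [0, 1]` that are `k`-layer networks with at most `N` parameters. -/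
def discriminatorNets (𝒜 : Set (ℝ → ℝ)) (k N d : ℕ) :
    Set (EuclideanSpace ℝ (Fin d) → ℝ) :=
  {D | (∃ 𝒩 : Net 𝒜 k d 1, 𝒩.numParams ≤ N ∧ ∀ x, D x = 𝒩.eval (WithLp.ofLp x) 0) ∧
    ∀ x, D x ∈ Icc (0 : ℝ) 1}

/-- The distribution of `G h` for a standard Gaussian `h`. -/
noncomputable def generatedLaw {n d : ℕ}
    (G : EuclideanSpace ℝ (Fin n) → EuclideanSpace ℝ (Fin d)) :
    Measure (EuclideanSpace ℝ (Fin d)) :=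
  (stdGaussian (EuclideanSpace ℝ (Fin n))).map G

/-- The payoff (to the discriminator) with measuring function `φ` and real distribution `μ`. -/
noncomputable def payoff {n d : ℕ} (φ : ℝ → ℝ) (μ : Measure (EuclideanSpace ℝ (Fin d)))
    (G : EuclideanSpace ℝ (Fin n) → EuclideanSpace ℝ (Fin d))
    (D : EuclideanSpace ℝ (Fin d) → ℝ) : ℝ :=
  (∫ x, φ (D x) ∂μ) + ∫ x, φ (1 - D x) ∂(generatedLaw G)

/-- `(G, D)` is an `ε`-approximate pure equilibrium with value `V` of the zero-sum game with payoff
`F`, in which a minimizing player chooses from `𝒢` and a maximizing player from `𝒟`. -/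
def IsApproxPureEquilibrium {α β : Type*} (F : α → β → ℝ) (𝒢 : Set α) (𝒟 : Set β)
    (ε V : ℝ) (G : α) (D : β) : Prop :=
  G ∈ 𝒢 ∧ D ∈ 𝒟 ∧ (∀ D' ∈ 𝒟, F G D' ≤ V + ε) ∧ ∀ G' ∈ 𝒢, V - ε ≤ F G' D

/-- A function on `ℝⁿ` as a function on `ℝⁿ⁺¹` that ignores the first coordinate. -/
noncomputable def ignoreFirst {n d : ℕ}
    (G : EuclideanSpace ℝ (Fin n) → EuclideanSpace ℝ (Fin d)) :
    EuclideanSpace ℝ (Fin (n + 1)) → EuclideanSpace ℝ (Fin d) :=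
  fun h => G (WithLp.toLp 2 (fun i : Fin n => h i.succ))

end GAN

namespace GAN

/-! The discriminator of the equilibrium is the constant 1/2. Against it every generator yields
exactly `2 * φ (1 / 2)` (`payoff_half`), which settles the lower bound. For the upper bound,
concavity gives φ(t) + φ(1 - t) ≤ 2φ(1/2) pointwise, so it suffices to find one generator network G₀
with E φ(1 - D_v(G₀ h)) ≤ E_μ φ(1 - D_v) + ε for all v.

Write Λ = LL'L_φ p/ε. Hoeffding's inequality and a union bound over a finite net of discriminator
parameters give about Δ²p log Λ/ε² points of the real distribution on which no D_v does better than
its mean by more than ε/2 (`exists_sample_lipschitz`). Each point is replaced by a generator close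
to it in mean, at cost ε/8. The uniform mixture of these generators is then the desired strategy,
except that it is not yet a single network.

The extra Gaussian input z turns the mixture into a network. The line is cut into intervals of equal
probability, one per generator (`exists_partition`). Two ReLU gates reading z vanish on the i-th
interval and have positive sum off it, up to a null set. Subtracting n times this sum before the
last ReLU of the i-th generator leaves it intact when z is in its interval and, for large n, kills
it otherwise (`exists_switched`). One more layer adds the gated generators. As n grows, this sum
equals the mixture outside a set of vanishing probability, so bounded test functions are matched up
to ε/8, uniformly (`exists_gates_mixture`).

Every layer has at least one bias, so depth and output width are bounded by the parameter count.
Gating therefore costs a constant factor, and the whole network has at most a constant times p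
parameters per sample point. -/

lemma relu_nonneg (t : ℝ) : 0 ≤ relu t := le_max_right _ _

lemma relu_of_nonneg {t : ℝ} (ht : 0 ≤ t) : relu t = t := max_eq_left ht

lemma relu_of_nonpos {t : ℝ} (ht : t ≤ 0) : relu t = 0 := max_eq_right ht

lemma measurable_relu : Measurable relu := measurable_id.max measurable_const

/-! ### Operations on single affine layers and their parameter counts. -/

namespace AffineLayer

variable {n n' n₁ n₂ m m₁ m₂ : ℕ}

/-- Two layers side by side, on separate inputs. -/
noncomputable def blockDiag (A : AffineLayer n₁ m₁) (B : AffineLayer n₂ m₂) :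
    AffineLayer (n₁ + n₂) (m₁ + m₂) where
  edges := A.edges.image (fun e => (Fin.castAdd m₂ e.1, Fin.castAdd n₂ e.2)) ∪
    B.edges.image (fun e => (Fin.natAdd m₁ e.1, Fin.natAdd n₁ e.2))
  weight := Fin.append (fun j => Fin.append (A.weight j) 0) (fun j => Fin.append 0 (B.weight j))
  bias := Fin.append A.bias B.bias

lemma castAdd_ne_natAdd (i : Fin n₁) (j : Fin n₂) : Fin.castAdd n₂ i ≠ Fin.natAdd n₁ j := by
  intro h
  have := congrArg Fin.val h
  simp at this
  omega

lemma preact_blockDiag (A : AffineLayer n₁ m₁) (B : AffineLayer n₂ m₂) (x : Fin n₁ → ℝ)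
    (y : Fin n₂ → ℝ) :
    (A.blockDiag B).preact (Fin.append x y) = Fin.append (A.preact x) (B.preact y) := by
  funext j
  refine Fin.addCases (fun j => ?_) (fun j => ?_) j <;>
    simp [preact, blockDiag, Fin.sum_univ_add, castAdd_ne_natAdd, (castAdd_ne_natAdd _ _).symm]

lemma numParams_blockDiag_le (A : AffineLayer n₁ m₁) (B : AffineLayer n₂ m₂) :
    (A.blockDiag B).numParams ≤ A.numParams + B.numParams := by
  have h := Finset.card_union_le
    (A.edges.image (fun e => (Fin.castAdd m₂ e.1, Fin.castAdd n₂ e.2)))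
    (B.edges.image (fun e => (Fin.natAdd m₁ e.1, Fin.natAdd n₁ e.2)))
  have h₁ := Finset.card_image_le (s := A.edges)
    (f := fun e => (Fin.castAdd m₂ e.1, Fin.castAdd n₂ e.2))
  have h₂ := Finset.card_image_le (s := B.edges)
    (f := fun e => (Fin.natAdd m₁ e.1, Fin.natAdd n₁ e.2))
  simp only [numParams, blockDiag]
  omega

/-- The layer whose input `i` is read from input `r i` of a larger list. -/
noncomputable def rewire (A : AffineLayer n m) (r : Fin n → Fin n') : AffineLayer n' m where
  edges := A.edges.image (fun e => (e.1, r e.2))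
  -- `r` need not be injective: connections that become parallel are merged by adding their weights.
  weight j i' := ∑ i, if (j, i) ∈ A.edges ∧ r i = i' then A.weight j i else 0
  bias := A.bias

lemma preact_rewire (A : AffineLayer n m) (r : Fin n → Fin n') (x : Fin n' → ℝ) :
    (A.rewire r).preact x = A.preact (x ∘ r) := by
  funext j
  have key : ∀ i', (if (j, i') ∈ (A.rewire r).edges then (A.rewire r).weight j i' * x i' else 0) =
      ∑ i, if r i = i' then (if (j, i) ∈ A.edges then A.weight j i * x i' else 0) else 0 := by
    intro i'
    have hw : (A.rewire r).weight j i' * x i' =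
        ∑ i, if r i = i' then (if (j, i) ∈ A.edges then A.weight j i * x i' else 0) else 0 := by
      simp only [rewire, Finset.sum_mul]
      refine Finset.sum_congr rfl fun i _ => ?_
      by_cases h₁ : r i = i' <;> by_cases h₂ : (j, i) ∈ A.edges <;> simp [h₁, h₂]
    split_ifs with h
    · exact hw
    · refine (Finset.sum_eq_zero fun i _ => ?_).symm
      split_ifs with h₁ h₂
      · exact absurd (Finset.mem_image.2 ⟨(j, i), h₂, by simp [h₁]⟩) h
      · rfl
      · rfl
  simp only [preact, key]
  rw [Finset.sum_comm]
  simp [rewire]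

lemma numParams_rewire_le (A : AffineLayer n m) (r : Fin n → Fin n') :
    (A.rewire r).numParams ≤ A.numParams :=
  Nat.add_le_add_right Finset.card_image_le _

/-- The layer that adds the values of two layers on separate inputs. -/
noncomputable def hcat (A : AffineLayer n₁ m) (B : AffineLayer n₂ m) :
    AffineLayer (n₁ + n₂) m where
  edges := A.edges.image (fun e => (e.1, Fin.castAdd n₂ e.2)) ∪
    B.edges.image (fun e => (e.1, Fin.natAdd n₁ e.2))
  weight j := Fin.append (A.weight j) (B.weight j)
  bias j := A.bias j + B.bias j

lemma preact_hcat (A : AffineLayer n₁ m) (B : AffineLayer n₂ m) (x : Fin n₁ → ℝ)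
    (y : Fin n₂ → ℝ) (j : Fin m) :
    (A.hcat B).preact (Fin.append x y) j = A.preact x j + B.preact y j := by
  simp [preact, hcat, Fin.sum_univ_add, castAdd_ne_natAdd, (castAdd_ne_natAdd _ _).symm]
  ring

lemma numParams_hcat_add_le (A : AffineLayer n₁ m) (B : AffineLayer n₂ m) :
    (A.hcat B).numParams + m ≤ A.numParams + B.numParams := by
  have h := Finset.card_union_le
    (A.edges.image (fun e => (e.1, Fin.castAdd n₂ e.2)))
    (B.edges.image (fun e => (e.1, Fin.natAdd n₁ e.2)))
  have h₁ := Finset.card_image_le (s := A.edges)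
    (f := fun e => (e.1, Fin.castAdd n₂ e.2))
  have h₂ := Finset.card_image_le (s := B.edges)
    (f := fun e => (e.1, Fin.natAdd n₁ e.2))
  simp only [numParams, hcat]
  omega

/-- The layer that copies its inputs. -/
noncomputable def copy (m : ℕ) : AffineLayer m m where
  edges := Finset.univ.diag
  weight _ _ := 1
  bias _ := 0

@[simp]
lemma preact_copy (x : Fin m → ℝ) : (copy m).preact x = x := by
  funext j
  simp [preact, copy]

@[simp]
lemma numParams_copy : (copy m).numParams = m + m := by
  simp [numParams, copy]

/-- The layer with all connections. -/
noncomputable def full (W : Fin m → Fin n → ℝ) (b : Fin m → ℝ) : AffineLayer n m where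
  edges := Finset.univ
  weight := W
  bias := b

@[simp]
lemma preact_full (W : Fin m → Fin n → ℝ) (b : Fin m → ℝ) (x : Fin n → ℝ) (j : Fin m) :
    (full W b).preact x j = (∑ i, W j i * x i) + b j := by
  simp [preact, full]

@[simp]
lemma numParams_full (W : Fin m → Fin n → ℝ) (b : Fin m → ℝ) :
    (full W b).numParams = m * n + m := by
  simp [numParams, full]

/-- The layer without connections. -/
noncomputable def const (b : Fin m → ℝ) : AffineLayer n m where
  edges := ∅
  weight _ _ := 0
  bias := b

@[simp]
lemma preact_const (b : Fin m → ℝ) (x : Fin n → ℝ) : (const b).preact x = b := by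
  funext j
  simp [preact, const]

@[simp]
lemma numParams_const (b : Fin m → ℝ) : (const b : AffineLayer n m).numParams = m := by
  simp [numParams, const]

lemma measurable_preact (A : AffineLayer n m) : Measurable A.preact := by
  refine measurable_pi_lambda _ fun j => (Finset.measurable_sum _ fun i _ => ?_).add_const _
  split_ifs
  · exact (measurable_pi_apply i).const_mul _
  · exact measurable_const

end AffineLayer

/-! ### Composing, gating and summing networks. -/

namespace Net

variable {𝒜 : Set (ℝ → ℝ)} {k n n' m m' n₁ n₂ m₁ m₂ q : ℕ}

lemma measurable_eval (h𝒜 : ∀ σ ∈ 𝒜, Measurable σ) (A : Net 𝒜 k n m) : Measurable A.eval := by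
  induction A with
  | output A =>
    exact measurable_pi_lambda _ fun j =>
      measurable_relu.comp ((measurable_pi_apply j).comp A.measurable_preact)
  | hidden A hw σ rest ih =>
    exact ih.comp (measurable_pi_lambda _ fun j =>
      (h𝒜 _ (σ j).2).comp ((measurable_pi_apply j).comp A.measurable_preact))

lemma eval_nonneg (A : Net 𝒜 k n m) (x : Fin n → ℝ) (j : Fin m) : 0 ≤ A.eval x j := by
  induction A with
  | output A => exact relu_nonneg _
  | hidden A hw σ rest ih => exact ih _ _

/-- Each hidden layer contributes at least one bias and the last layer contributes `m`. This absorbs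
overheads in depth and output width into multiples of the parameter count. -/
lemma depth_add_width_le (A : Net 𝒜 k n m) : k + m ≤ A.numParams + 1 := by
  induction A with
  | output A => simp only [numParams, AffineLayer.numParams]; omega
  | hidden A hw σ rest ih => simp only [numParams, AffineLayer.numParams]; omega

lemma depth_pos (A : Net 𝒜 k n m) : 0 < k := by
  cases A <;> omega

lemma exists_rewire (A : Net 𝒜 k n m) (r : Fin n → Fin n') :
    ∃ B : Net 𝒜 k n' m, B.numParams ≤ A.numParams ∧ ∀ x, B.eval x = A.eval (x ∘ r) := by
  cases A with
  | output A =>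
    refine ⟨.output (A.rewire r), A.numParams_rewire_le r, fun x => ?_⟩
    simp [eval, A.preact_rewire]
  | hidden A hw σ rest =>
    refine ⟨.hidden (A.rewire r) hw σ rest, ?_, fun x => ?_⟩
    · have := A.numParams_rewire_le r
      simp only [numParams]
      omega
    · simp [eval, A.preact_rewire]

lemma apply_append {α β γ : Type*} (f : α → β → γ) (a : Fin m₁ → α) (a' : Fin m₂ → α)
    (b : Fin m₁ → β) (b' : Fin m₂ → β) :
    (fun j => f (Fin.append a a' j) (Fin.append b b' j)) =
      Fin.append (fun j => f (a j) (b j)) (fun j => f (a' j) (b' j)) := by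
  funext j
  refine Fin.addCases (fun j => ?_) (fun j => ?_) j <;> simp

lemma exists_blockDiag (A : Net 𝒜 k n₁ m₁) : ∀ {n₂ m₂ : ℕ} (B : Net 𝒜 k n₂ m₂),
    ∃ C : Net 𝒜 k (n₁ + n₂) (m₁ + m₂), C.numParams ≤ A.numParams + B.numParams ∧
      ∀ x y, C.eval (Fin.append x y) = Fin.append (A.eval x) (B.eval y) := by
  induction A with
  | output A =>
    intro n₂ m₂ B
    cases B with
    | output B =>
      refine ⟨.output (A.blockDiag B), A.numParams_blockDiag_le B, fun x y => ?_⟩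
      simp only [eval, A.preact_blockDiag B]
      funext j
      refine Fin.addCases (fun j => ?_) (fun j => ?_) j <;> simp
    -- Equal depths exclude the mixed cases: `rest` would have depth 0.
    | hidden B hw σ rest => exact absurd rest.depth_pos (lt_irrefl 0)
  | hidden A hw σ rest ih =>
    intro n₂ m₂ B
    cases B with
    | output B => exact absurd rest.depth_pos (lt_irrefl 0)
    | hidden B hw' τ rest' =>
      obtain ⟨C, hC, hCe⟩ := ih rest'
      refine ⟨.hidden (A.blockDiag B) (by omega) (Fin.append σ τ) C, ?_, fun x y => ?_⟩
      · have := A.numParams_blockDiag_le B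
        simp only [numParams]
        omega
      · simp only [eval, A.preact_blockDiag B]
        rw [apply_append (fun (s : 𝒜) t => (s : ℝ → ℝ) t), hCe]

/-- Two networks that read the same input, side by side. -/
lemma exists_pair (A : Net 𝒜 k n m₁) (B : Net 𝒜 k n m₂) :
    ∃ C : Net 𝒜 k n (m₁ + m₂), C.numParams ≤ A.numParams + B.numParams ∧
      ∀ x, C.eval x = Fin.append (A.eval x) (B.eval x) := by
  obtain ⟨C, hC, hCe⟩ := exists_blockDiag A B
  obtain ⟨C', hC', hCe'⟩ := C.exists_rewire (Fin.append id id : Fin (n + n) → Fin n)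
  refine ⟨C', hC'.trans hC, fun x => ?_⟩
  rw [hCe', ← hCe]
  congr 1
  funext j
  refine Fin.addCases (fun j => ?_) (fun j => ?_) j <;>
    simp only [Function.comp_apply, Fin.append_left, Fin.append_right, id]

/-- A network followed by one more layer. -/
lemma exists_append (hrelu : relu ∈ 𝒜) (A : Net 𝒜 k n m) (hm : 0 < m) (M : AffineLayer m m') :
    ∃ C : Net 𝒜 (k + 1) n m', C.numParams = A.numParams + M.numParams ∧
      ∀ x j, C.eval x j = relu (M.preact (A.eval x) j) := by
  induction A with
  | output A => exact ⟨.hidden A hm (fun _ => ⟨relu, hrelu⟩) (.output M), rfl, fun x j => rfl⟩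
  | hidden A hw σ rest ih =>
    obtain ⟨C, hC, hCe⟩ := ih hm M
    refine ⟨.hidden A hw σ C, ?_, fun x j => hCe _ _⟩
    simp only [numParams, hC]
    omega

/-- Every network computes the same function as a network with one more layer. -/
lemma exists_succ (hrelu : relu ∈ 𝒜) (A : Net 𝒜 k n m) (hm : 0 < m) :
    ∃ C : Net 𝒜 (k + 1) n m, C.numParams = A.numParams + (m + m) ∧ C.eval = A.eval := by
  obtain ⟨C, hC, hCe⟩ := A.exists_append hrelu hm (AffineLayer.copy m)
  refine ⟨C, by simpa using hC, ?_⟩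
  funext x j
  rw [hCe, AffineLayer.preact_copy, relu_of_nonneg (A.eval_nonneg x j)]

/-- The biases of the last layer carry the constant; each hidden layer is a single unconnected gate.
-/
lemma exists_const (hrelu : relu ∈ 𝒜) (k n : ℕ) (c : Fin m → ℝ) (hc : ∀ j, 0 ≤ c j) :
    ∃ C : Net 𝒜 (k + 1) n m, C.numParams = k + m ∧ ∀ x, C.eval x = c := by
  induction k generalizing n with
  | zero =>
    refine ⟨.output (AffineLayer.const c), by simp [numParams], fun x => ?_⟩
    simp [eval, relu_of_nonneg (hc _)]
  | succ k ih =>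
    obtain ⟨C, hC, hCe⟩ := ih 1
    refine ⟨.hidden (AffineLayer.const 0) one_pos (fun _ => ⟨relu, hrelu⟩) C, ?_,
      fun x => hCe _⟩
    simp only [numParams, hC, AffineLayer.numParams_const]
    omega

/-- A network with `q` additional nonnegative inputs which are subtracted, with a common factor,
before the last application of ReLU. -/
lemma exists_gated (hrelu : relu ∈ 𝒜) (q : ℕ) (A : Net 𝒜 k n m) :
    ∃ g : (Fin n → ℝ) → Fin m → ℝ, (∀ x j, relu (g x j) = A.eval x j) ∧
      ∀ b : ℝ, ∃ C : Net 𝒜 k (n + q) m, C.numParams + 2 * q ≤ A.numParams + 2 * q * k + q * m ∧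
        ∀ x s, (∀ i, 0 ≤ s i) →
          ∀ j, C.eval (Fin.append x s) j = relu (g x j - b * ∑ i, s i) := by
  induction A with
  | @output n m A =>
    -- `g` is the value entering the output gates. It is fixed before `b`, because `b` is later sent
    -- to infinity with `g` unchanged.
    refine ⟨A.preact, fun x j => rfl, fun b =>
      ⟨.output (A.hcat (AffineLayer.full (fun _ (_ : Fin q) => -b) 0)), ?_, fun x s _ j => ?_⟩⟩
    · have := A.numParams_hcat_add_le (AffineLayer.full (fun _ (_ : Fin q) => -b) 0)
      rw [AffineLayer.numParams_full] at this
      simp only [numParams]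
      nlinarith
    · simp [eval, AffineLayer.preact_hcat, Finset.mul_sum, sub_eq_add_neg]
  | @hidden k n w m A hw σ rest ih =>
    obtain ⟨g, hg, hC⟩ := ih
    refine ⟨_, fun x j => hg (fun j => (σ j : ℝ → ℝ) (A.preact x j)) j, fun b => ?_⟩
    obtain ⟨C, hC, hCe⟩ := hC b
    -- The extra inputs pass through a hidden layer on ReLU copies, which are faithful because the
    -- inputs are nonnegative. Each copy costs one weight and one bias, hence the term `2 * q * k`.
    refine ⟨.hidden (A.blockDiag (AffineLayer.copy q)) (by omega)
      (Fin.append σ fun _ => ⟨relu, hrelu⟩) C, ?_, fun x s hs j => ?_⟩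
    · have := A.numParams_blockDiag_le (AffineLayer.copy q)
      rw [AffineLayer.numParams_copy] at this
      simp only [numParams]
      nlinarith
    · simp only [eval, AffineLayer.preact_blockDiag, AffineLayer.preact_copy]
      rw [apply_append (fun (s : 𝒜) t => (s : ℝ → ℝ) t), hCe _ _ (fun i => relu_nonneg _)]
      simp only [relu_of_nonneg (hs _)]

/-- A network with one additional input `z` (the first one), which is switched off by two gates
that read `z`. -/
lemma exists_switched (hrelu : relu ∈ 𝒜) (hk : 2 ≤ k) (A : Net 𝒜 k n m) :
    ∃ g : (Fin n → ℝ) → Fin m → ℝ, (∀ x j, relu (g x j) = A.eval x j) ∧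
      ∀ (b : ℝ) (α β : Fin 2 → ℝ), ∃ C : Net 𝒜 k (n + 1) m,
        C.numParams + 4 ≤ A.numParams + 4 * k + 2 * m ∧
        ∀ z x j, C.eval (Fin.cons z x) j = relu (g x j - b * ∑ i, relu (α i * z + β i)) := by
  cases A with
  | output A => omega
  | @hidden k n w m A hw σ rest =>
    -- The two gates reading `z` sit in the first hidden layer, and their outputs are the extra
    -- inputs of `rest`. This needs a hidden layer, hence `2 ≤ k`.
    obtain ⟨g, hg, hC⟩ := rest.exists_gated hrelu 2
    refine ⟨_, fun x j => hg (fun j => (σ j : ℝ → ℝ) (A.preact x j)) j, fun b α β => ?_⟩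
    obtain ⟨C, hC, hCe⟩ := hC b
    let M := AffineLayer.full (fun i (_ : Fin 1) => α i) β
    obtain ⟨C', hC', hCe'⟩ := (Net.hidden (A.blockDiag M) (by omega)
      (Fin.append σ fun _ => ⟨relu, hrelu⟩) C).exists_rewire
        (Fin.append Fin.succ (fun _ => 0) : Fin (n + 1) → Fin (n + 1))
    refine ⟨C', ?_, fun z x j => ?_⟩
    · have := A.numParams_blockDiag_le M
      rw [AffineLayer.numParams_full] at this
      simp only [numParams] at hC' ⊢
      omega
    · have : (Fin.cons z x : Fin (n + 1) → ℝ) ∘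
          (Fin.append Fin.succ (fun _ => 0) : Fin (n + 1) → Fin (n + 1)) =
            Fin.append x fun _ : Fin 1 => z := by
        funext j
        refine Fin.addCases (fun j => ?_) (fun j => ?_) j <;> simp
      rw [hCe', this]
      simp only [eval, AffineLayer.preact_blockDiag]
      rw [apply_append (fun (s : 𝒜) t => (s : ℝ → ℝ) t), hCe _ _ (fun i => relu_nonneg _)]
      simp [M]

/-- The summing layer `M` is kept apart from `P`, so that the induction extends both and the final
ReLU is applied only once. Starting from one network instead of none keeps the width positive. -/
lemma exists_parallel_sum {T c : ℕ} (C : Fin (T + 1) → Net 𝒜 k n m)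
    (hC : ∀ i, (C i).numParams ≤ c) :
    ∃ (w : ℕ) (P : Net 𝒜 k n w) (M : AffineLayer w m), (0 < m → 0 < w) ∧
      P.numParams ≤ (T + 1) * c ∧ M.numParams ≤ (T + 1) * m + m ∧
      ∀ x j, M.preact (P.eval x) j = ∑ i, (C i).eval x j := by
  induction T with
  | zero =>
    exact ⟨m, C 0, AffineLayer.copy m, id, by simpa using hC 0, by simp, fun x j => by simp⟩
  | succ T ih =>
    obtain ⟨w, P, M, hw, hP, hM, he⟩ := ih (fun i => C i.castSucc) fun i => hC _
    obtain ⟨Q, hQ, hQe⟩ := P.exists_pair (C (Fin.last _))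
    refine ⟨w + m, Q, M.hcat (AffineLayer.copy m), fun h => by omega, ?_, ?_, fun x j => ?_⟩
    · have := hC (Fin.last _)
      linarith
    · have := M.numParams_hcat_add_le (AffineLayer.copy m)
      rw [AffineLayer.numParams_copy] at this
      linarith
    · rw [hQe, AffineLayer.preact_hcat, he, Fin.sum_univ_castSucc (n := T + 1),
        AffineLayer.preact_copy]

/-- The sum of finitely many networks of the same depth, with one more layer. -/
lemma exists_sum (hrelu : relu ∈ 𝒜) {T c : ℕ} (hm : 0 < m) (C : Fin (T + 1) → Net 𝒜 k n m)
    (hC : ∀ i, (C i).numParams ≤ c) :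
    ∃ S : Net 𝒜 (k + 1) n m, S.numParams ≤ (T + 1) * c + (T + 1) * m + m ∧
      ∀ x j, S.eval x j = ∑ i, (C i).eval x j := by
  obtain ⟨w, P, M, hw, hP, hM, he⟩ := exists_parallel_sum C hC
  obtain ⟨S, hS, hSe⟩ := P.exists_append hrelu (hw hm) M
  refine ⟨S, by omega, fun x j => ?_⟩
  rw [hSe, he, relu_of_nonneg (Finset.sum_nonneg fun i _ => (C i).eval_nonneg x j)]

end Net

/-! ### Cutting the line into intervals of equal probability. -/

/-- Without atoms the distribution function is continuous, and it tends to 0 and 1 at the two ends.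
-/
lemma exists_measureReal_Iic_eq (ν : Measure ℝ) [IsProbabilityMeasure ν] [NullSingletonClass ν] {c : ℝ}
    (h0 : 0 < c) (h1 : c < 1) : ∃ t, ν.real (Iic t) = c := by
  have hcont : Continuous (cdf ν) := by
    refine continuous_iff_continuousAt.2 fun x => ?_
    have hx : (cdf ν).measure {x} = 0 := by rw [measure_cdf]; exact measure_singleton x
    rw [StieltjesFunction.measure_singleton, ENNReal.ofReal_eq_zero] at hx
    have hl : Function.leftLim (cdf ν) x = cdf ν x :=
      le_antisymm ((cdf ν).mono.leftLim_le le_rfl) (by linarith)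
    exact continuousAt_iff_continuous_left_right.2
      ⟨((cdf ν).mono.continuousWithinAt_Iio_iff_leftLim_eq.2 hl).insert.mono
        fun y hy => by simpa [le_iff_eq_or_lt] using hy, (cdf ν).right_continuous x⟩
  obtain ⟨t, ht⟩ := mem_range_of_exists_le_of_exists_ge hcont
    (((tendsto_cdf_atBot ν).eventually_lt_const h0).exists.imp fun _ => le_of_lt)
    (((tendsto_cdf_atTop ν).eventually_const_lt h1).exists.imp fun _ => le_of_lt)
  exact ⟨t, by rw [← cdf_eq_real, ht]⟩

/-- The real line is cut into `T` intervals of equal probability, each of which is recognized by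
two gates up to a null set. -/
lemma exists_partition (ν : Measure ℝ) [IsProbabilityMeasure ν] [NullSingletonClass ν] {T : ℕ}
    (hT : 0 < T) :
    ∃ (W : Fin T → Set ℝ) (α β : Fin T → Fin 2 → ℝ), (∀ i, MeasurableSet (W i)) ∧
      (∀ i, ν.real (W i) = 1 / T) ∧ (∀ z, ∃! i, z ∈ W i) ∧
      ∀ᵐ z ∂ν, ∀ i, (z ∈ W i → ∑ c, relu (α i c * z + β i c) = 0) ∧
        (z ∉ W i → 0 < ∑ c, relu (α i c * z + β i c)) := by
  have hT' : (0 : ℝ) < T := by exact_mod_cast hT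
  have hq : ∀ i : ℕ, ∃ t, 0 < i → i < T → ν.real (Iic t) = i / T := by
    intro i
    by_cases hi : 0 < i ∧ i < T
    · obtain ⟨t, ht⟩ := exists_measureReal_Iic_eq ν (c := i / T)
        (div_pos (by exact_mod_cast hi.1) hT') ((div_lt_one hT').2 (by exact_mod_cast hi.2))
      exact ⟨t, fun _ _ => ht⟩
    · exact ⟨0, fun h h' => absurd ⟨h, h'⟩ hi⟩
  choose t ht using hq
  -- Initial segments of probability `i / T`; the ends are `∅` and `univ`, so no infinite endpoints
  -- are needed.
  let A : ℕ → Set ℝ := fun i => if i = 0 then ∅ else if i < T then Iic (t i) else univ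
  have hA0 : A 0 = ∅ := by simp [A]
  have hAT : A T = univ := by simp [A, hT.ne']
  have hAm : ∀ i, MeasurableSet (A i) := by
    intro i
    simp only [A]
    split_ifs
    exacts [MeasurableSet.empty, measurableSet_Iic, MeasurableSet.univ]
  have hAν : ∀ i ≤ T, ν.real (A i) = i / T := by
    intro i hi
    simp only [A]
    split_ifs with h₁ h₂
    · simp [h₁]
    · exact ht i (by omega) h₂
    · rw [probReal_univ, show i = T by omega, div_self hT'.ne']
  have hmono : ∀ i j, i ≤ j → A i ⊆ A j := by
    intro i j hij
    rcases eq_or_lt_of_le hij with rfl | hij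
    · exact Subset.rfl
    by_cases hi : i = 0
    · rw [hi, hA0]
      exact empty_subset _
    by_cases hj : j < T
    · have hAi : A i = Iic (t i) := by simp [A, hi, hij.trans hj]
      have hAj : A j = Iic (t j) := by simp [A, (show j ≠ 0 by omega), hj]
      rw [hAi, hAj]
      -- Quantiles in the wrong order would give probabilities in the wrong order.
      refine Iic_subset_Iic.2 (le_of_not_gt fun hlt => ?_)
      have h : ν.real (A j) ≤ ν.real (A i) :=
        measureReal_mono (by rw [hAi, hAj]; exact Iic_subset_Iic.2 hlt.le)
      rw [hAν i (hij.trans hj).le, hAν j hj.le, div_le_div_iff_of_pos_right hT'] at h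
      have : j ≤ i := by exact_mod_cast h
      omega
    · have hAj : A j = univ := by simp [A, (show j ≠ 0 by omega), hj]
      rw [hAj]
      exact subset_univ _
  -- The gates are `relu (t i - z)` and `relu (z - t (i + 1))`; at an unbounded end the
  -- corresponding gate is identically zero.
  refine ⟨fun i => A (i + 1) \ A i,
    fun i => ![if (i : ℕ) = 0 then 0 else -1, if (i : ℕ) + 1 < T then 1 else 0],
    fun i => ![if (i : ℕ) = 0 then 0 else t i, if (i : ℕ) + 1 < T then -t (i + 1) else 0],
    fun i => (hAm _).diff (hAm _), fun i => ?_, fun z => ?_, ?_⟩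
  · have h := measureReal_sdiff_add_inter (μ := ν) (s := A (i + 1)) (hAm i)
    rw [inter_eq_self_of_subset_right (hmono i (i + 1) (Nat.le_succ _)),
      hAν _ i.2, hAν _ i.2.le] at h
    push_cast at h
    have : ((i : ℝ) + 1) / T = i / T + 1 / T := add_div _ _ _
    linarith
  · classical
    -- The interval containing `z` is one before the first segment that contains it.
    have hex : ∃ n, z ∈ A n := ⟨T, by rw [hAT]; trivial⟩
    have hn0 : Nat.find hex ≠ 0 := fun h => by
      have := Nat.find_spec hex
      rw [h, hA0] at this
      exact this
    have hnT : Nat.find hex ≤ T := Nat.find_min' hex (by rw [hAT]; trivial)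
    refine ⟨⟨Nat.find hex - 1, by omega⟩, ⟨?_, Nat.find_min hex (show Nat.find hex - 1 < _ by omega)⟩, ?_⟩
    · simp only
      rw [Nat.sub_add_cancel (by omega)]
      exact Nat.find_spec hex
    · rintro i ⟨hi, hi'⟩
      have h₁ : Nat.find hex ≤ i + 1 := Nat.find_min' hex hi
      have h₂ : ¬ Nat.find hex ≤ i := fun h => hi' (hmono _ _ h (Nat.find_spec hex))
      apply Fin.ext
      simp only
      omega
  -- The cut points form a null set; away from them strict and weak inequalities agree.
  · have hne : ∀ᵐ z ∂ν, ∀ i, z ≠ t i := by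
      rw [ae_all_iff]
      intro i
      rw [ae_iff]
      simp
    filter_upwards [hne] with z hz i
    have hlo : z ∈ A i ↔ (i : ℕ) ≠ 0 ∧ z < t i := by
      by_cases h : (i : ℕ) = 0
      · simp [A, h]
      · simp [A, h, i.2, le_iff_lt_or_eq, hz]
    have hhi : z ∈ A (i + 1) ↔ ((i : ℕ) + 1 < T → z < t (i + 1)) := by
      by_cases h : (i : ℕ) + 1 < T
      · simp [A, h, le_iff_lt_or_eq, hz]
      · simp [A, h]
    rw [mem_sdiff, hlo, hhi]
    have r1 : ∀ u : ℝ, 0 < u → 0 < relu u := fun u hu => lt_max_of_lt_left hu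
    simp only [Fin.sum_univ_two, Matrix.cons_val_zero, Matrix.cons_val_one]
    constructor
    · rintro ⟨h₁, h₂⟩
      have e1 : relu ((if (i : ℕ) = 0 then 0 else -1) * z + if (i : ℕ) = 0 then 0 else t i) = 0 := by
        apply relu_of_nonpos
        split_ifs with h
        · simp
        · have := not_lt.1 fun h' => h₂ ⟨h, h'⟩
          linarith
      have e2 : relu ((if (i : ℕ) + 1 < T then 1 else 0) * z +
          if (i : ℕ) + 1 < T then -t (i + 1) else 0) = 0 := by
        apply relu_of_nonpos
        split_ifs with h
        · have := h₁ h
          linarith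
        · simp
      rw [e1, e2, add_zero]
    · intro h
      by_cases h₂ : (i : ℕ) ≠ 0 ∧ z < t i
      · refine add_pos_of_pos_of_nonneg (r1 _ ?_) (relu_nonneg _)
        rw [if_neg h₂.1, if_neg h₂.1]
        linarith [h₂.2]
      · refine add_pos_of_nonneg_of_pos (relu_nonneg _) (r1 _ ?_)
        have h₁ : ¬ ((i : ℕ) + 1 < T → z < t (i + 1)) := fun h' => h ⟨h', h₂⟩
        push Not at h₁
        rw [if_pos h₁.1, if_pos h₁.1]
        have := lt_of_le_of_ne h₁.2 (hz _).symm
        linarith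

/-! ### Realizing a uniform mixture with one extra Gaussian input. -/

/-- A standard Gaussian vector is built from a standard Gaussian number and an independent
standard Gaussian vector of smaller dimension. -/
lemma measurePreserving_cons (n : ℕ) :
    MeasurePreserving (fun q : ℝ × EuclideanSpace ℝ (Fin n) =>
        (WithLp.toLp 2 (Fin.cons q.1 (WithLp.ofLp q.2) : Fin (n + 1) → ℝ) :
          EuclideanSpace ℝ (Fin (n + 1))))
      ((gaussianReal 0 1).prod (stdGaussian (EuclideanSpace ℝ (Fin n))))
      (stdGaussian (EuclideanSpace ℝ (Fin (n + 1)))) := by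
  have hto : ∀ m : ℕ, MeasurePreserving
      (MeasurableEquiv.toLp 2 (Fin m → ℝ)) (Measure.pi fun _ => gaussianReal 0 1)
      (stdGaussian (EuclideanSpace ℝ (Fin m))) := fun m =>
    ⟨(MeasurableEquiv.toLp 2 (Fin m → ℝ)).measurable, map_pi_eq_stdGaussian⟩
  have h := (hto (n + 1)).comp (((measurePreserving_piFinSuccAbove
    (fun _ : Fin (n + 1) => gaussianReal 0 1) 0).symm _).comp
      ((MeasurePreserving.id (gaussianReal 0 1)).prod ((hto n).symm _)))
  have heq : (fun q : ℝ × EuclideanSpace ℝ (Fin n) =>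
      (WithLp.toLp 2 (Fin.cons q.1 (WithLp.ofLp q.2) : Fin (n + 1) → ℝ) :
        EuclideanSpace ℝ (Fin (n + 1)))) = MeasurableEquiv.toLp 2 (Fin (n + 1) → ℝ) ∘
      (MeasurableEquiv.piFinSuccAbove (fun _ => ℝ) 0).symm ∘
        Prod.map id (MeasurableEquiv.toLp 2 (Fin n → ℝ)).symm := by
    funext q
    ext i
    refine Fin.cases ?_ (fun i => ?_) i <;> rfl
  rw [heq]
  exact h

/-- On `s` the two functions differ by at most the length `2 * Δ` of their common range. -/
lemma integral_le_add_of_ne {X : Type*} [MeasurableSpace X] {ν : Measure X}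
    [IsProbabilityMeasure ν] {u v : X → ℝ} (hu : Measurable u) (hv : Measurable v) {Δ : ℝ}
    (hu' : ∀ x, u x ∈ Icc (-Δ) Δ) (hv' : ∀ x, v x ∈ Icc (-Δ) Δ) {s : Set X}
    (hs : MeasurableSet s) (huv : ∀ x ∉ s, u x = v x) :
    ∫ x, u x ∂ν ≤ ∫ x, v x ∂ν + 2 * Δ * ν.real s := by
  have hui : Integrable u ν := Integrable.of_mem_Icc _ _ hu.aemeasurable (ae_of_all _ hu')
  have hvi : Integrable v ν := Integrable.of_mem_Icc _ _ hv.aemeasurable (ae_of_all _ hv')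
  have hsi : Integrable (s.indicator fun _ => 2 * Δ) ν :=
    (integrable_const (2 * Δ)).indicator hs
  have h : ∫ x, u x ∂ν ≤ ∫ x, v x + s.indicator (fun _ => 2 * Δ) x ∂ν := by
    refine integral_mono hui (hvi.add hsi) fun x => ?_
    by_cases hx : x ∈ s
    · simp only [indicator_of_mem hx]
      linarith [(hu' x).2, (hv' x).1]
    · simp only [indicator_of_notMem hx]
      linarith [huv x hx]
  rw [integral_add hvi hsi, integral_indicator_const _ hs, smul_eq_mul] at h
  linarith

/-- A sum of gated generators approximates the uniform mixture of the generators in total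
variation, when the gates are driven by one additional Gaussian input. -/
lemma exists_gates_mixture {l d T : ℕ} (hT : 0 < T)
    (G : Fin T → EuclideanSpace ℝ (Fin l) → EuclideanSpace ℝ (Fin d))
    (hG : ∀ i, Measurable (G i)) (g : Fin T → (Fin l → ℝ) → Fin d → ℝ)
    (hg : ∀ i h j, G i h j = relu (g i (WithLp.ofLp h) j)) {Δ δ : ℝ} (hΔ : 0 < Δ) (hδ : 0 < δ) :
    ∃ α β : Fin T → Fin 2 → ℝ,
      ∀ S : ℕ → EuclideanSpace ℝ (Fin (l + 1)) → EuclideanSpace ℝ (Fin d),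
      (∀ n, Measurable (S n)) →
      (∀ n z h j, S n (WithLp.toLp 2 (Fin.cons z h)) j =
        ∑ i, relu (g i h j - n * ∑ c, relu (α i c * z + β i c))) →
      ∃ n, ∀ f : EuclideanSpace ℝ (Fin d) → ℝ, Measurable f → (∀ x, f x ∈ Icc (-Δ) Δ) →
        ∫ h, f (S n h) ∂(stdGaussian (EuclideanSpace ℝ (Fin (l + 1)))) ≤
          1 / T * ∑ i, ∫ h, f (G i h) ∂(stdGaussian (EuclideanSpace ℝ (Fin l))) + δ := by
  classical
  have : NullSingletonClass (gaussianReal 0 1) := nullSingletonClass_gaussianReal one_ne_zero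
  obtain ⟨W, α, β, hWm, hWν, hWex, hW⟩ := exists_partition (gaussianReal 0 1) hT
  -- The gates depend only on `T`; the networks `S n` are built from them afterwards.
  refine ⟨α, β, fun S hS hSe => ?_⟩
  let ν := (gaussianReal 0 1).prod (stdGaussian (EuclideanSpace ℝ (Fin l)))
  let cons : ℝ × EuclideanSpace ℝ (Fin l) → EuclideanSpace ℝ (Fin (l + 1)) :=
    fun q => WithLp.toLp 2 (Fin.cons q.1 (WithLp.ofLp q.2) : Fin (l + 1) → ℝ)
  have hcons : MeasurePreserving cons ν _ := measurePreserving_cons l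
  let mix : ℝ × EuclideanSpace ℝ (Fin l) → EuclideanSpace ℝ (Fin d) :=
    fun q => ∑ i, (W i).indicator (fun _ => G i q.2) q.1
  have hWfst : ∀ i, MeasurableSet
      ((fun q : ℝ × EuclideanSpace ℝ (Fin l) => q.1) ⁻¹' W i) := fun i => measurable_fst (hWm i)
  have hmix : Measurable mix := Finset.measurable_sum _ fun i _ =>
    ((hG i).comp measurable_snd).indicator (hWfst i)
  have hmix_eq : ∀ q i, q.1 ∈ W i → mix q = G i q.2 := by
    intro q i hi
    simp only [mix]
    rw [Finset.sum_eq_single i, indicator_of_mem hi]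
    · intro j _ hj
      exact indicator_of_notMem (fun h => hj ((hWex q.1).unique h hi)) _
    · simp
  let bad : ℕ → Set (ℝ × EuclideanSpace ℝ (Fin l)) := fun n => {q | S n (cons q) = mix q}ᶜ
  have hbad : ∀ n, MeasurableSet (bad n) := fun n =>
    (measurableSet_eq_fun ((hS n).comp hcons.measurable) hmix).compl
  have hev : ∀ᵐ q ∂ν, ∀ᶠ n in Filter.atTop, q ∈ bad n ↔ q ∈ (∅ : Set _) := by
    filter_upwards [Measure.quasiMeasurePreserving_fst.ae hW] with q hq
    obtain ⟨i, hi, hi'⟩ := hWex q.1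
    -- Off its own interval a gate sum is positive, so `n` times it eventually exceeds the fixed
    -- value of `g`.
    have hgate : ∀ᶠ n : ℕ in Filter.atTop, ∀ (i' : Fin T) (j : Fin d), i' ≠ i →
        g i' (WithLp.ofLp q.2) j ≤ n * ∑ c, relu (α i' c * q.1 + β i' c) := by
      simp only [Filter.eventually_all]
      intro i' j hne
      have hpos := (hq i').2 fun h => hne (hi' i' h)
      exact ((tendsto_natCast_atTop_atTop).atTop_mul_const hpos).eventually_ge_atTop _
    filter_upwards [hgate] with n hn
    simp only [bad, mem_compl_iff, mem_ofPred_eq, mem_empty_iff_false, iff_false, not_not]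
    ext j
    rw [hmix_eq q i hi, hSe, Finset.sum_eq_single i, (hq i).1 hi, hg, mul_zero, sub_zero]
    · intro i' _ hne
      exact relu_of_nonpos (by linarith [hn i' j hne])
    · simp
  -- Almost sure eventual agreement becomes convergence in measure. The resulting `n` does not
  -- depend on the test function `f`.
  have hlim : Filter.Tendsto (fun n => ν (bad n)) Filter.atTop (nhds 0) := by
    simpa using tendsto_measure_of_ae_tendsto_indicator_of_isFiniteMeasure Filter.atTop
      MeasurableSet.empty hbad hev
  obtain ⟨n, hn⟩ := (hlim.eventually_lt_const
    (show 0 < ENNReal.ofReal (δ / (2 * Δ)) by simp; positivity)).exists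
  have hn' : ν.real (bad n) ≤ δ / (2 * Δ) :=
    ENNReal.toReal_le_of_le_ofReal (by positivity) hn.le
  refine ⟨n, fun f hf hfΔ => ?_⟩
  rw [← hcons.map_eq, integral_map (f := fun h => f (S n h)) hcons.aemeasurable
    (hf.comp (hS n)).aestronglyMeasurable]
  have h1 := integral_le_add_of_ne (ν := ν) (hf.comp ((hS n).comp hcons.measurable))
    (hf.comp hmix) (fun q => hfΔ _) (fun q => hfΔ _) (hbad n) fun q hq => by
      simp only [bad, mem_compl_iff, mem_ofPred_eq, not_not] at hq
      simp [hq]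
  have h2 : ∫ q, f (mix q) ∂ν =
      1 / T * ∑ i, ∫ h, f (G i h) ∂(stdGaussian (EuclideanSpace ℝ (Fin l))) := by
    have hsum : ∀ q, f (mix q) = ∑ i, (W i).indicator 1 q.1 * f (G i q.2) := by
      intro q
      obtain ⟨i, hi, hi'⟩ := hWex q.1
      rw [hmix_eq q i hi, Finset.sum_eq_single i]
      · simp [hi]
      · intro j _ hj
        simp [indicator_of_notMem fun h => hj (hi' j h)]
      · simp
    simp only [hsum]
    rw [integral_finsetSum, Finset.mul_sum]
    · refine Finset.sum_congr rfl fun i _ => ?_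
      -- The selecting input is independent of the generator's input, and each interval has
      -- probability `1 / T`.
      have h := integral_prod_mul (μ := gaussianReal 0 1)
        (ν := stdGaussian (EuclideanSpace ℝ (Fin l))) ((W i).indicator 1) fun h => f (G i h)
      rwa [integral_indicator_one (hWm i), hWν] at h
    · intro i _
      exact Integrable.mul_prod ((integrable_const 1).indicator (hWm i))
        (Integrable.of_mem_Icc _ _ (hf.comp (hG i)).aemeasurable (ae_of_all _ fun _ => hfΔ _))
  have h3 : 2 * Δ * ν.real (bad n) ≤ δ := by
    rw [le_div_iff₀ (by positivity)] at hn'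
    linarith
  simp only [Function.comp_apply] at h1
  linarith

/-! ### Sampling and finite nets. -/

/-- A uniform one-sided law of large numbers for finitely many bounded functions; the sample
points may be chosen in any set of full measure. -/
lemma exists_sample {X ι : Type*} [MeasurableSpace X] (μ : Measure X) [IsProbabilityMeasure μ]
    (S : Finset ι) (f : ι → X → ℝ) (hf : ∀ s ∈ S, Measurable (f s)) {Δ : ℝ} (hΔ : 0 < Δ)
    (hfΔ : ∀ s ∈ S, ∀ x, f s x ∈ Icc (-Δ) Δ) {P : X → Prop} (hP : ∀ᵐ x ∂μ, P x) {T : ℕ}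
    {τ : ℝ} (hτ : 0 ≤ τ) (hT : 0 < T)
    (hS : S.card * Real.exp (-(T * τ ^ 2) / (2 * Δ ^ 2)) < 1) :
    ∃ x : Fin T → X, (∀ i, P (x i)) ∧ ∀ s ∈ S, ∑ i, f s (x i) ≤ T * (∫ y, f s y ∂μ + τ) := by
  let ν : Measure (Fin T → X) := Measure.pi fun _ => μ
  let bad : ι → Set (Fin T → X) := fun s =>
    {x | T * τ ≤ ∑ i, (f s (x i) - ∫ y, f s y ∂μ)}
  have hbad : ∀ s ∈ S, ν.real (bad s) ≤ Real.exp (-(T * τ ^ 2) / (2 * Δ ^ 2)) := by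
    intro s hs
    -- Hoeffding's lemma on an interval of length `2 * Δ`: the variance proxy is `Δ ^ 2`.
    have hsub : HasSubgaussianMGF (fun y => f s y - ∫ y, f s y ∂μ) ((‖Δ - -Δ‖₊ / 2) ^ 2) μ :=
      hasSubgaussianMGF_of_mem_Icc (hf s hs).aemeasurable (ae_of_all _ (hfΔ s hs))
    have hind : iIndepFun (fun i (x : Fin T → X) => f s (x i) - ∫ y, f s y ∂μ) ν :=
      iIndepFun_pi (X := fun (_ : Fin T) (y : X) => f s y - ∫ y, f s y ∂μ)
        fun i => ((hf s hs).sub_const _).aemeasurable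
    have hsub' : ∀ i ∈ (Finset.univ : Finset (Fin T)), HasSubgaussianMGF
        (fun x : Fin T → X => f s (x i) - ∫ y, f s y ∂μ) ((‖Δ - -Δ‖₊ / 2) ^ 2) ν := by
      intro i _
      have hmap : ν.map (Function.eval i) = μ := (measurePreserving_eval (fun _ => μ) i).map_eq
      refine HasSubgaussianMGF.of_map (X := fun y : X => f s y - ∫ y, f s y ∂μ)
        (Y := fun x : Fin T → X => x i) (measurable_pi_apply i).aemeasurable ?_
      rwa [hmap]
    have h := HasSubgaussianMGF.measure_sum_ge_le_of_iIndepFun hind hsub' (ε := T * τ)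
      (by positivity)
    refine h.trans (Real.exp_le_exp.2 (le_of_eq ?_))
    have : (‖Δ - -Δ‖ / 2) = Δ := by
      rw [sub_neg_eq_add, ← two_mul, Real.norm_of_nonneg (by positivity)]
      ring
    have hT' : (T : ℝ) ≠ 0 := by positivity
    simp only [Finset.sum_const, Finset.card_univ, Fintype.card_fin, nsmul_eq_mul]
    push_cast
    rw [this]
    field_simp
  have hU : ν.real (⋃ s ∈ S, bad s) < 1 := by
    refine lt_of_le_of_lt ((measureReal_biUnion_finset_le S bad).trans
      (Finset.sum_le_sum hbad)) ?_
    simpa using hS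
  have hPν : ∀ᵐ x ∂ν, ∀ i, P (x i) := by
    rw [ae_all_iff]
    intro i
    exact (Measure.quasiMeasurePreserving_eval (fun _ : Fin T => μ) i).ae hP
  -- The good samples have positive probability, so they cannot all lie in the null set where `P`
  -- fails at some coordinate.
  have hne : ν (⋃ s ∈ S, bad s)ᶜ ≠ 0 := by
    intro h0
    have h1 : ν univ ≤ ν (⋃ s ∈ S, bad s) := by
      rw [← union_compl_self (⋃ s ∈ S, bad s)]
      exact (measure_union_le _ _).trans (by rw [h0, add_zero])
    have h2 : ν.real univ ≤ ν.real (⋃ s ∈ S, bad s) :=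
      ENNReal.toReal_mono (measure_ne_top _ _) h1
    rw [probReal_univ] at h2
    linarith
  obtain ⟨x, hx, hxP⟩ : ∃ x ∈ (⋃ s ∈ S, bad s)ᶜ, ∀ i, P (x i) := by
    by_contra! hcon
    refine hne (measure_mono_null (fun x hx => ?_) (ae_iff.1 hPν))
    simpa using hcon x hx
  refine ⟨x, hxP, fun s hs => ?_⟩
  have : x ∉ bad s := fun h => hx (mem_biUnion hs h)
  simp only [bad, mem_ofPred_eq, not_le, Finset.sum_sub_distrib, Finset.sum_const,
    Finset.card_univ, Fintype.card_fin, nsmul_eq_mul] at this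
  linarith

/-- A finite net in a subset of the unit ball. -/
lemma exists_finite_net {p : ℕ} (V : Set (EuclideanSpace ℝ (Fin p)))
    (hV : V ⊆ Metric.closedBall 0 1) {m : ℕ} (hm : 0 < m) :
    ∃ S : Finset (EuclideanSpace ℝ (Fin p)), (S : Set _) ⊆ V ∧ S.card ≤ (2 * m + 1) ^ p ∧
      ∀ v ∈ V, ∃ s ∈ S, ‖v - s‖ ≤ p / m := by
  classical
  -- Grid cells of side `1 / m`. One representative is chosen in each cell that meets `V`, so the
  -- net stays inside `V`, where the later hypotheses hold.
  let r : EuclideanSpace ℝ (Fin p) → Fin p → ℤ := fun v i => ⌊m * v i⌋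
  let B : Finset (Fin p → ℤ) := Fintype.piFinset fun _ => Finset.Icc (-m : ℤ) m
  have hm' : (0 : ℝ) < m := by exact_mod_cast hm
  have hB : ∀ v ∈ V, r v ∈ B := by
    intro v hv
    simp only [B, Fintype.mem_piFinset, Finset.mem_Icc]
    intro i
    have h1 : |v i| ≤ 1 := by
      have := (PiLp.norm_apply_le v i).trans (mem_closedBall_zero_iff.1 (hV hv))
      simpa using this
    rw [abs_le] at h1
    constructor
    · refine Int.le_floor.2 ?_
      push_cast
      nlinarith
    · have h2 : (⌊m * v i⌋ : ℝ) ≤ m := (Int.floor_le _).trans (by nlinarith)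
      exact_mod_cast h2
  have hex : ∀ c ∈ r '' V, ∃ v, v ∈ V ∧ r v = c := by
    rintro c ⟨v, hv, rfl⟩
    exact ⟨v, hv, rfl⟩
  choose! g hgV hgr using hex
  have hfin : (r '' V).Finite := B.finite_toSet.subset (by rintro _ ⟨v, hv, rfl⟩; exact hB v hv)
  refine ⟨hfin.toFinset.image g, ?_, ?_, fun v hv => ?_⟩
  · intro s hs
    simp only [Finset.coe_image, Finite.coe_toFinset] at hs
    obtain ⟨c, hc, rfl⟩ := hs
    exact hgV c hc
  · refine Finset.card_image_le.trans ((Finset.card_le_card (t := B) ?_).trans (le_of_eq ?_))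
    · intro c hc
      obtain ⟨v, hv, rfl⟩ := hfin.mem_toFinset.1 hc
      exact hB v hv
    · simp only [B, Fintype.card_piFinset, Int.card_Icc, Finset.prod_const, Finset.card_univ,
        Fintype.card_fin]
      congr 1
      omega
  · have hrv : r v ∈ r '' V := mem_image_of_mem r hv
    refine ⟨g (r v), Finset.mem_image_of_mem g (hfin.mem_toFinset.2 hrv), ?_⟩
    have hcoord : ∀ i, ‖(v - g (r v)) i‖ ≤ 1 / m := by
      intro i
      have h := congrFun (hgr _ hrv) i
      have h' := Int.abs_sub_lt_one_of_floor_eq_floor h.symm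
      rw [← mul_sub, abs_mul, abs_of_pos hm'] at h'
      rw [PiLp.sub_apply, Real.norm_eq_abs, le_div_iff₀ hm']
      linarith
    have hsum : ‖v - g (r v)‖ ≤ ∑ i, ‖(v - g (r v)) i‖ := by
      rw [EuclideanSpace.norm_eq]
      exact Real.sqrt_le_iff.2 ⟨Finset.sum_nonneg fun i _ => norm_nonneg _,
        Finset.sum_sq_le_sq_sum_of_nonneg fun i _ => norm_nonneg _⟩
    refine hsum.trans ((Finset.sum_le_sum fun i _ => hcoord i).trans (le_of_eq ?_))
    simp [div_eq_mul_inv]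

/-! ### Membership in the network classes. -/

variable {𝒜 : Set (ℝ → ℝ)} {k p l d : ℕ}

lemma measurable_of_mem_generatorNets (h𝒜 : ∀ σ ∈ 𝒜, Measurable σ) {N : ℕ}
    {G : EuclideanSpace ℝ (Fin l) → EuclideanSpace ℝ (Fin d)} (hG : G ∈ generatorNets 𝒜 k N l d) :
    Measurable G := by
  obtain ⟨A, -, hA⟩ := hG
  rw [show G = fun h => WithLp.toLp 2 (A.eval (WithLp.ofLp h)) from funext hA]
  exact (MeasurableEquiv.toLp 2 (Fin d → ℝ)).measurable.comp
    ((A.measurable_eval h𝒜).comp (MeasurableEquiv.toLp 2 (Fin l → ℝ)).symm.measurable)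

lemma depth_add_width_le_of_mem_generatorNets {N : ℕ}
    {G : EuclideanSpace ℝ (Fin l) → EuclideanSpace ℝ (Fin d)} (hG : G ∈ generatorNets 𝒜 k N l d) :
    k + d ≤ N + 1 := by
  obtain ⟨A, hA, -⟩ := hG
  have := A.depth_add_width_le
  omega

/-- The uniform mixture of finitely many generators is approximated, in total variation, by a
generator network with one more layer and one more Gaussian input. -/
lemma exists_generatorNets_mixture (hrelu : relu ∈ 𝒜) (h𝒜 : ∀ σ ∈ 𝒜, Measurable σ) (hk : 2 ≤ k)
    {T : ℕ} (G : Fin (T + 1) → EuclideanSpace ℝ (Fin l) → EuclideanSpace ℝ (Fin d))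
    (hG : ∀ i, G i ∈ generatorNets 𝒜 k p l d) {Δ δ : ℝ} (hΔ : 0 < Δ) (hδ : 0 < δ) :
    ∃ G₀ ∈ generatorNets 𝒜 (k + 1) (7 * (T + 1) * p) (l + 1) d,
      ∀ f : EuclideanSpace ℝ (Fin d) → ℝ, Measurable f → (∀ x, f x ∈ Icc (-Δ) Δ) →
        ∫ h, f (G₀ h) ∂(stdGaussian (EuclideanSpace ℝ (Fin (l + 1)))) ≤
          1 / (T + 1 : ℕ) * ∑ i, ∫ h, f (G i h) ∂(stdGaussian (EuclideanSpace ℝ (Fin l))) + δ := by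
  have hkd := depth_add_width_le_of_mem_generatorNets (hG 0)
  have hTp : p ≤ (T + 1) * p := Nat.le_mul_of_pos_left p T.succ_pos
  -- Output dimension 0 is separate: the summing layer needs a non-empty layer below it.
  rcases Nat.eq_zero_or_pos d with rfl | hd
  · obtain ⟨A, hA, -⟩ := Net.exists_const hrelu k (l + 1) (fun _ : Fin 0 => 0) (by simp)
    refine ⟨_, ⟨A, by rw [hA, mul_assoc]; omega, fun h => rfl⟩, fun f _ _ => ?_⟩
    have hf : ∀ x, f x = f 0 := fun x => congrArg f (Subsingleton.elim _ _)
    simp only [hf _, integral_const, probReal_univ, one_smul, Finset.sum_const,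
      Finset.card_univ, Fintype.card_fin, nsmul_eq_mul]
    rw [← mul_assoc, one_div_mul_cancel (by positivity), one_mul]
    linarith
  choose A hA hAe using hG
  choose g hg hC using fun i => (A i).exists_switched hrelu hk
  obtain ⟨α, β, hS⟩ := exists_gates_mixture T.succ_pos G
    (fun i => measurable_of_mem_generatorNets h𝒜 ⟨A i, hA i, hAe i⟩) g
    (fun i h j => by rw [hAe, hg]) hΔ hδ
  choose C hCp hCe using fun (n : ℕ) (i : Fin (T + 1)) => hC i n (α i) (β i)
  choose B hB hBe using fun n : ℕ =>
    -- Gating adds at most `4 * k + 2 * d - 4`, which is at most `4 * p` because `k + d ≤ p + 1`.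
    Net.exists_sum (c := 5 * p) hrelu hd (C n) fun i => by
      have := hCp n i
      have := hA i
      omega
  let S : ℕ → EuclideanSpace ℝ (Fin (l + 1)) → EuclideanSpace ℝ (Fin d) :=
    fun n h => WithLp.toLp 2 ((B n).eval (WithLp.ofLp h))
  have hmem : ∀ n, S n ∈ generatorNets 𝒜 (k + 1) (7 * (T + 1) * p) (l + 1) d := by
    refine fun n => ⟨B n, (hB n).trans ?_, fun h => rfl⟩
    have h1 : (T + 1) * d ≤ (T + 1) * p := Nat.mul_le_mul_left _ (by omega)
    have h2 : (T + 1) * (5 * p) = 5 * ((T + 1) * p) := by ring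
    rw [h2, mul_assoc]
    omega
  obtain ⟨n, hn⟩ := hS S (fun n => measurable_of_mem_generatorNets h𝒜 (hmem n))
    fun n z h j => by simp only [S, hBe, hCe]
  exact ⟨S n, hmem n, hn⟩

lemma ignoreFirst_mem_generatorNets (hrelu : relu ∈ 𝒜) {N : ℕ}
    {G : EuclideanSpace ℝ (Fin l) → EuclideanSpace ℝ (Fin d)}
    (hG : G ∈ generatorNets 𝒜 k p l d) (hp : 0 < p) (hN : 3 * p ≤ N) :
    ignoreFirst G ∈ generatorNets 𝒜 (k + 1) N (l + 1) d := by
  have hkd := depth_add_width_le_of_mem_generatorNets hG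
  rcases Nat.eq_zero_or_pos d with rfl | hd
  · obtain ⟨A, hA, -⟩ := Net.exists_const hrelu k (l + 1) (fun _ : Fin 0 => 0) (by simp)
    exact ⟨A, by omega, fun h => Subsingleton.elim _ _⟩
  · obtain ⟨A, hA, hAe⟩ := hG
    obtain ⟨B, hB, hBe⟩ := A.exists_rewire (Fin.succ : Fin l → Fin (l + 1))
    obtain ⟨C, hC, hCe⟩ := B.exists_succ hrelu hd
    have := A.depth_pos
    refine ⟨C, by omega, fun h => ?_⟩
    rw [ignoreFirst, hAe, hCe, hBe]
    rfl

lemma mem_discriminatorNets_succ (hrelu : relu ∈ 𝒜) {N : ℕ} {D : EuclideanSpace ℝ (Fin d) → ℝ}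
    (hD : D ∈ discriminatorNets 𝒜 k p d) (hN : p + 2 ≤ N) :
    D ∈ discriminatorNets 𝒜 (k + 1) N d := by
  obtain ⟨⟨A, hA, hAe⟩, hD'⟩ := hD
  obtain ⟨C, hC, hCe⟩ := A.exists_succ hrelu one_pos
  exact ⟨⟨C, by omega, fun x => by rw [hAe, hCe]⟩, hD'⟩

lemma half_mem_discriminatorNets (hrelu : relu ∈ 𝒜) {N : ℕ} (hN : k + 1 ≤ N) :
    (fun _ => 1 / 2) ∈ discriminatorNets 𝒜 (k + 1) N d := by
  obtain ⟨C, hC, hCe⟩ := Net.exists_const hrelu k d (fun _ : Fin 1 => 1 / 2) (by norm_num)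
  exact ⟨⟨C, by omega, fun x => by rw [hCe]⟩, fun x => by norm_num⟩

/-! ### Estimates for the payoff. -/

lemma payoff_half (φ : ℝ → ℝ) (μ : Measure (EuclideanSpace ℝ (Fin d))) [IsProbabilityMeasure μ]
    {G : EuclideanSpace ℝ (Fin l) → EuclideanSpace ℝ (Fin d)} (hG : Measurable G) :
    payoff φ μ G (fun _ => 1 / 2) = 2 * φ (1 / 2) := by
  have : IsProbabilityMeasure (generatedLaw G) := Measure.isProbabilityMeasure_map hG.aemeasurable
  simp only [payoff, integral_const, probReal_univ, one_smul]
  norm_num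
  ring

/-- A generator that is close to a point in mean is almost as good as the point mass. -/
lemma integral_comp_le_of_lipschitz {K L' : NNReal}
    {G : EuclideanSpace ℝ (Fin l) → EuclideanSpace ℝ (Fin d)} (hG : LipschitzWith L' G)
    {f : EuclideanSpace ℝ (Fin d) → ℝ} (hf : LipschitzWith K f) (x : EuclideanSpace ℝ (Fin d)) :
    ∫ h, f (G h) ∂(stdGaussian (EuclideanSpace ℝ (Fin l))) ≤
      f x + K * ∫ h, ‖G h - x‖ ∂(stdGaussian (EuclideanSpace ℝ (Fin l))) := by
  have hid : Integrable (fun h => ‖h‖) (stdGaussian (EuclideanSpace ℝ (Fin l))) :=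
    IsGaussian.integrable_id.norm
  -- A Lipschitz map grows linearly and Gaussians have a first moment. Without integrability the
  -- mean distance would be 0 by convention and carry no information.
  have hint : Integrable (fun h => ‖G h - x‖) (stdGaussian (EuclideanSpace ℝ (Fin l))) := by
    refine Integrable.mono' ((hid.const_mul L').add (integrable_const ‖G 0 - x‖))
      (hG.continuous.sub continuous_const).norm.aestronglyMeasurable (ae_of_all _ fun h => ?_)
    have h1 := hG.dist_le_mul h 0
    rw [dist_eq_norm, dist_zero_right] at h1
    have h2 := norm_sub_le_norm_sub_add_norm_sub (G h) (G 0) x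
    simp only [norm_norm, Pi.add_apply]
    linarith
  have hle : ∀ h, |f (G h) - f x| ≤ K * ‖G h - x‖ := fun h => by
    simpa [dist_eq_norm] using hf.dist_le_mul (G h) x
  have hfi : Integrable (fun h => f (G h) - f x) (stdGaussian (EuclideanSpace ℝ (Fin l))) :=
    Integrable.mono' (hint.const_mul K)
      ((hf.continuous.comp hG.continuous).sub continuous_const).aestronglyMeasurable
      (ae_of_all _ hle)
  have h := integral_mono hfi (hint.const_mul K) fun h => (le_abs_self _).trans (hle h)
  have hadd : ∫ h, f (G h) ∂(stdGaussian (EuclideanSpace ℝ (Fin l))) =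
      ∫ h, (f (G h) - f x) ∂(stdGaussian (EuclideanSpace ℝ (Fin l))) + f x := by
    have : ∀ h, f (G h) = (f (G h) - f x) + f x := fun h => by ring
    rw [integral_congr_ae (ae_of_all _ this), integral_add hfi (integrable_const _)]
    simp
  rw [integral_const_mul] at h
  linarith

/-- The point 1/2 is the midpoint of `t` and `1 - t`. -/
lemma concaveOn_add_one_sub_le {φ : ℝ → ℝ} (hφ : ConcaveOn ℝ (Icc 0 1) φ) {t : ℝ}
    (ht : t ∈ Icc (0 : ℝ) 1) : φ t + φ (1 - t) ≤ 2 * φ (1 / 2) := by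
  have ht' : 1 - t ∈ Icc (0 : ℝ) 1 := ⟨by linarith [ht.2], by linarith [ht.1]⟩
  have h := hφ.2 ht ht' (show (0 : ℝ) ≤ 1 / 2 by norm_num) (show (0 : ℝ) ≤ 1 / 2 by norm_num)
    (by norm_num)
  simp only [smul_eq_mul] at h
  rw [show 1 / 2 * t + 1 / 2 * (1 - t) = 1 / 2 by ring] at h
  linarith

/-! ### Sample size and constants. -/

/-- The number of sample points that suffices for a net of discriminators. -/
lemma card_mul_exp_lt_one {p m T n : ℕ} {Δ ε Λ : ℝ} (hΔ : 0 < Δ) (hε : 0 < ε) (hΛ : 2 ≤ Λ)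
    (hm : (m : ℝ) ≤ 8 * Λ + 1) (hn : n ≤ (2 * m + 1) ^ p)
    (hT : 192 * (Δ ^ 2 * p * Real.log Λ / ε ^ 2) < T) :
    n * Real.exp (-(T * (ε / 4) ^ 2) / (2 * Δ ^ 2)) < 1 := by
  have hΛ0 : 0 < Λ := by linarith
  have h1 : (n : ℝ) ≤ (2 * m + 1) ^ p := by exact_mod_cast hn
  -- `2 * m + 1 ≤ 16 * Λ + 3 ≤ 32 * Λ`, and `32 ≤ Λ ^ 5`; so the logarithm of the net size is at
  -- most `6 * p * log Λ`.
  have h2 : (2 * m + 1 : ℝ) ≤ Λ ^ 6 := by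
    have : (2 : ℝ) ^ 5 ≤ Λ ^ 5 := pow_le_pow_left₀ (by norm_num) hΛ 5
    have : (32 : ℝ) * Λ ≤ Λ ^ 6 := by
      rw [pow_succ Λ 5]
      exact mul_le_mul_of_nonneg_right (by linarith) hΛ0.le
    linarith
  have h3 : (n : ℝ) ≤ Real.exp (6 * p * Real.log Λ) := by
    refine h1.trans ((pow_le_pow_left₀ (by positivity) h2 p).trans (le_of_eq ?_))
    rw [← pow_mul, ← Real.exp_log (pow_pos hΛ0 (6 * p)), Real.log_pow]
    push_cast
    rfl
  refine (mul_le_mul_of_nonneg_right h3 (Real.exp_pos _).le).trans_lt ?_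
  rw [← Real.exp_add, Real.exp_lt_one_iff]
  -- The Hoeffding exponent is `T * ε ^ 2 / (32 * Δ ^ 2)`, whence the constant 192 = 6 · 32.
  have h4 : 192 * (Δ ^ 2 * p * Real.log Λ / ε ^ 2) * (ε / 4) ^ 2 / (2 * Δ ^ 2) =
      6 * p * Real.log Λ := by
    field_simp
    ring
  have h5 : 192 * (Δ ^ 2 * p * Real.log Λ / ε ^ 2) * (ε / 4) ^ 2 / (2 * Δ ^ 2) <
      T * (ε / 4) ^ 2 / (2 * Δ ^ 2) := by gcongr
  rw [neg_div]
  linarith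

/-- A sample of the real distribution on which no discriminator does much better than on the real
distribution itself. -/
lemma exists_sample_lipschitz {p d T : ℕ} {V : Set (EuclideanSpace ℝ (Fin p))}
    (hV : V ⊆ Metric.closedBall 0 1)
    (f : EuclideanSpace ℝ (Fin p) → EuclideanSpace ℝ (Fin d) → ℝ) {Δ ε Λ K : ℝ} (hΔ : 0 < Δ)
    (hε : 0 < ε) (hΛ : 2 ≤ Λ) (hK0 : 0 ≤ K) (hK : K * p ≤ Λ * ε)
    (hfm : ∀ v ∈ V, Measurable (f v)) (hfΔ : ∀ v ∈ V, ∀ x, f v x ∈ Icc (-Δ) Δ)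
    (hfK : ∀ v ∈ V, ∀ w ∈ V, ∀ x, f v x ≤ f w x + K * ‖v - w‖)
    (μ : Measure (EuclideanSpace ℝ (Fin d))) [IsProbabilityMeasure μ]
    {P : EuclideanSpace ℝ (Fin d) → Prop} (hP : ∀ᵐ x ∂μ, P x) (hT0 : 0 < T)
    (hT : 192 * (Δ ^ 2 * p * Real.log Λ / ε ^ 2) < T) :
    ∃ x : Fin T → EuclideanSpace ℝ (Fin d), (∀ i, P (x i)) ∧
      ∀ v ∈ V, ∑ i, f v (x i) ≤ T * (∫ y, f v y ∂μ + ε / 2) := by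
  -- With this mesh, moving to the net changes a test function by at most `K * p / (8 * Λ) ≤ ε / 8`.
  -- This is paid twice, on the sample and on `μ`; with the sampling error `ε / 4` the total is `ε /
  -- 2`.
  have hm : 0 < ⌈8 * Λ⌉₊ := Nat.ceil_pos.2 (by linarith)
  have hm' : (0 : ℝ) < ⌈8 * Λ⌉₊ := by exact_mod_cast hm
  obtain ⟨S, hSV, hScard, hSnet⟩ := exists_finite_net V hV hm
  obtain ⟨x, hxP, hx⟩ := exists_sample μ S f (fun s hs => hfm s (hSV hs)) hΔ
    (fun s hs => hfΔ s (hSV hs)) hP (τ := ε / 4) (by positivity) hT0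
    (card_mul_exp_lt_one hΔ hε hΛ (Nat.ceil_lt_add_one (by linarith)).le hScard hT)
  refine ⟨x, hxP, fun v hv => ?_⟩
  obtain ⟨s, hs, hvs⟩ := hSnet v hv
  have hsV : s ∈ V := hSV hs
  have hclose : K * ‖v - s‖ ≤ ε / 8 := by
    refine (mul_le_mul_of_nonneg_left hvs hK0).trans ?_
    rw [← mul_div_assoc, div_le_iff₀ hm']
    have := mul_le_mul_of_nonneg_left (Nat.le_ceil (8 * Λ)) hε.le
    linarith
  have h1 : ∑ i, f v (x i) ≤ ∑ i, f s (x i) + T * (ε / 8) := by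
    have : ∑ i, f v (x i) ≤ ∑ i, (f s (x i) + ε / 8) :=
      Finset.sum_le_sum fun i _ => (hfK v hv s hsV (x i)).trans (by linarith)
    simpa [Finset.sum_add_distrib] using this
  have hint : ∀ w ∈ V, Integrable (f w) μ := fun w hw =>
    Integrable.of_mem_Icc _ _ (hfm w hw).aemeasurable (ae_of_all _ (hfΔ w hw))
  have h2 : ∫ y, f s y ∂μ ≤ ∫ y, f v y ∂μ + ε / 8 := by
    have : ∫ y, f s y ∂μ ≤ ∫ y, (f v y + ε / 8) ∂μ :=
      integral_mono (hint s hsV) ((hint v hv).add (integrable_const _)) fun y =>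
        (hfK s hsV v hv y).trans (by rw [norm_sub_rev]; linarith)
    rw [integral_add (hint v hv) (integrable_const _)] at this
    simpa using this
  have h3 := hx s hs
  have h4 : (T : ℝ) * ∫ y, f s y ∂μ ≤ T * (∫ y, f v y ∂μ + ε / 8) :=
    mul_le_mul_of_nonneg_left h2 (Nat.cast_nonneg T)
  linarith

/-- The hypotheses force `Δ ^ 2 * p * log Λ / ε ^ 2 ≥ 1 / 32`, so the `+ 1` after the floor is
absorbed: 7 · (192 + 32) = 1568 ≤ 1600. -/
lemma natCast_sample_params_le {Δ ε Λ : ℝ} {p : ℕ} (hε : 0 < ε) (hεΔ : ε ≤ 4 * Δ)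
    (hΛ : 2 ≤ Λ) (hp : 0 < p) :
    ((7 * (⌊192 * (Δ ^ 2 * p * Real.log Λ / ε ^ 2)⌋₊ + 1) * p : ℕ) : ℝ) ≤
      1600 * (Δ ^ 2 * (p : ℝ) ^ 2 * Real.log Λ / ε ^ 2) := by
  have hp' : (1 : ℝ) ≤ p := by exact_mod_cast hp
  have hlog : 1 / 2 ≤ Real.log Λ := by
    have := Real.log_two_gt_d9
    have := Real.log_le_log two_pos hΛ
    linarith
  have hX : 1 / 32 ≤ Δ ^ 2 * p * Real.log Λ / ε ^ 2 := by
    rw [le_div_iff₀ (by positivity)]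
    have h1 : ε ^ 2 ≤ 16 * Δ ^ 2 := by nlinarith
    have h2 : Δ ^ 2 * (1 / 2) ≤ Δ ^ 2 * (p * Real.log Λ) :=
      mul_le_mul_of_nonneg_left (by nlinarith) (sq_nonneg Δ)
    linarith
  have hfloor := Nat.floor_le (show 0 ≤ 192 * (Δ ^ 2 * p * Real.log Λ / ε ^ 2) by linarith)
  have heq : Δ ^ 2 * (p : ℝ) ^ 2 * Real.log Λ / ε ^ 2 =
      Δ ^ 2 * p * Real.log Λ / ε ^ 2 * p := by ring
  rw [heq]
  push_cast
  nlinarith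

end GAN

/-! ### Assembling the equilibrium. -/

theorem theorem4p3 :
    ∃ C : ℝ, 0 < C ∧
      ∀ (𝒜 : Set (ℝ → ℝ)), GAN.relu ∈ 𝒜 → (∀ σ ∈ 𝒜, Measurable σ) →
      ∀ (k p l d : ℕ), 2 ≤ k →
      -- the measuring function
      ∀ (φ : ℝ → ℝ) (Δ : ℝ) (L L' Lφ : NNReal),
        ConcaveOn ℝ (Icc 0 1) φ → (∀ t ∈ Icc (0 : ℝ) 1, φ t ∈ Icc (-Δ) Δ) →
        LipschitzOnWith Lφ φ (Icc 0 1) →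
      -- the generators
      ∀ (U : Set (EuclideanSpace ℝ (Fin p)))
        (G : EuclideanSpace ℝ (Fin p) → EuclideanSpace ℝ (Fin l) → EuclideanSpace ℝ (Fin d)),
        U ⊆ Metric.closedBall 0 1 →
        (∀ u ∈ U, G u ∈ GAN.generatorNets 𝒜 k p l d) →
        (∀ h, LipschitzOnWith L (fun u => G u h) U) →
        (∀ u ∈ U, LipschitzWith L' (G u)) →
      -- the discriminators
      ∀ (𝒱 : Set (EuclideanSpace ℝ (Fin p)))
        (D : EuclideanSpace ℝ (Fin p) → EuclideanSpace ℝ (Fin d) → ℝ),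
        𝒱 ⊆ Metric.closedBall 0 1 →
        (∀ v ∈ 𝒱, D v ∈ GAN.discriminatorNets 𝒜 k p d) →
        (∀ x, LipschitzOnWith L (fun v => D v x) 𝒱) →
        (∀ v ∈ 𝒱, LipschitzWith L' (D v)) →
      -- the real distribution; the generators approximate the point masses at its points
      ∀ (μ : Measure (EuclideanSpace ℝ (Fin d))), IsProbabilityMeasure μ →
        (∀ᵐ x ∂μ, ∀ η : ℝ, 0 < η →
          ∃ u ∈ U, ∫ h, ‖G u h - x‖ ∂(stdGaussian (EuclideanSpace ℝ (Fin l))) ≤ η) →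
      ∀ ε : ℝ, 0 < ε → ε ≤ 4 * Δ → 1 ≤ L' → 2 ≤ (L * L' * Lφ * p / ε : ℝ) →
      ∃ N : ℕ,
        (N : ℝ) ≤ C * (Δ ^ 2 * (p : ℝ) ^ 2 * Real.log (L * L' * Lφ * p / ε) / ε ^ 2) ∧
        (∀ u ∈ U, GAN.ignoreFirst (G u) ∈ GAN.generatorNets 𝒜 (k + 1) N (l + 1) d) ∧
        (∀ v ∈ 𝒱, D v ∈ GAN.discriminatorNets 𝒜 (k + 1) N d) ∧
        ∃ G₀ ∈ GAN.generatorNets 𝒜 (k + 1) N (l + 1) d,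
        ∃ D₀ ∈ GAN.discriminatorNets 𝒜 (k + 1) N d,
          GAN.IsApproxPureEquilibrium (GAN.payoff φ μ)
            (GAN.generatorNets 𝒜 (k + 1) N (l + 1) d) (insert D₀ (D '' 𝒱))
            ε (2 * φ (1 / 2)) G₀ D₀ := by
  refine ⟨1600, by norm_num, ?_⟩
  intro 𝒜 hrelu h𝒜 k p l d hk φ Δ L L' Lφ hφc hφΔ hφL U G hU hG hGL hGL' 𝒱 D h𝒱 hD hDL hDL'
    μ hμ happrox ε hε hεΔ hL' hΛ
  have hΔ : 0 < Δ := by linarith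
  have hp : 0 < p := by
    rcases Nat.eq_zero_or_pos p with rfl | hp
    · norm_num at hΛ
    · exact hp
  have hp' : (0 : ℝ) < p := by exact_mod_cast hp
  have hLp : 0 < (L * L' * Lφ * p : ℝ) := by
    by_contra h
    have : (L * L' * Lφ * p / ε : ℝ) ≤ 0 := div_nonpos_of_nonpos_of_nonneg (not_lt.1 h) hε.le
    linarith
  have hLφ0 : (0 : ℝ) < Lφ := by
    refine lt_of_le_of_ne Lφ.coe_nonneg fun h => ?_
    rw [← h] at hLp
    simp at hLp
  have hL'1 : (1 : ℝ) ≤ L' := by exact_mod_cast hL'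
  set Λ : ℝ := L * L' * Lφ * p / ε with hΛdef
  have hD1 : ∀ v ∈ 𝒱, ∀ x, 1 - D v x ∈ Icc (0 : ℝ) 1 := fun v hv x =>
    ⟨by linarith [((hD v hv).2 x).2], by linarith [((hD v hv).2 x).1]⟩
  have hfL : ∀ v ∈ 𝒱, LipschitzWith (Lφ * L') fun x => φ (1 - D v x) := by
    intro v hv
    refine LipschitzWith.of_dist_le_mul fun x y => ?_
    have h1 := hφL.dist_le_mul _ (hD1 v hv x) _ (hD1 v hv y)
    have h2 := (hDL' v hv).dist_le_mul x y
    rw [dist_sub_left] at h1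
    push_cast
    rw [mul_assoc]
    exact h1.trans (mul_le_mul_of_nonneg_left h2 Lφ.coe_nonneg)
  have hfm : ∀ v ∈ 𝒱, Measurable fun x => φ (1 - D v x) := fun v hv =>
    (hfL v hv).continuous.measurable
  have hfΔ : ∀ v ∈ 𝒱, ∀ x, φ (1 - D v x) ∈ Icc (-Δ) Δ := fun v hv x => hφΔ _ (hD1 v hv x)
  have hfK : ∀ v ∈ 𝒱, ∀ w ∈ 𝒱, ∀ x,
      φ (1 - D v x) ≤ φ (1 - D w x) + (Lφ * L : ℝ) * ‖v - w‖ := by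
    intro v hv w hw x
    have h1 := hφL.dist_le_mul _ (hD1 v hv x) _ (hD1 w hw x)
    have h2 := (hDL x).dist_le_mul _ hv _ hw
    rw [dist_sub_left] at h1
    have h3 := h1.trans (mul_le_mul_of_nonneg_left h2 Lφ.coe_nonneg)
    rw [Real.dist_eq, dist_eq_norm] at h3
    have := le_abs_self (φ (1 - D v x) - φ (1 - D w x))
    linarith
  -- The net needs only the constant `Lφ * L`; the factor `L' ≥ 1` in `Λ` can only help.
  have hK : (Lφ * L : ℝ) * p ≤ Λ * ε := by
    rw [hΛdef, div_mul_cancel₀ _ hε.ne']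
    have : (0 : ℝ) ≤ L * Lφ * p := by positivity
    nlinarith
  set T := ⌊192 * (Δ ^ 2 * p * Real.log Λ / ε ^ 2)⌋₊ with hTdef
  have hT : 192 * (Δ ^ 2 * p * Real.log Λ / ε ^ 2) < (T + 1 : ℕ) := by
    push_cast
    exact Nat.lt_floor_add_one _
  obtain ⟨x, hxP, hx⟩ := GAN.exists_sample_lipschitz h𝒱 (fun v x => φ (1 - D v x)) hΔ hε hΛ
    (by positivity) hK hfm hfΔ hfK μ happrox T.succ_pos hT
  -- `Lφ * L'` is the Lipschitz constant of `φ (1 - D v ·)`, so this accuracy costs `ε / 8`.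
  choose u huU hu using fun i => hxP i (ε / (8 * (Lφ * L'))) (by positivity)
  obtain ⟨G₀, hG₀, hG₀f⟩ := GAN.exists_generatorNets_mixture hrelu h𝒜 hk (fun i => G (u i))
    (fun i => hG _ (huU i)) hΔ (show 0 < ε / 8 by positivity)
  have hkd := GAN.depth_add_width_le_of_mem_generatorNets (hG _ (huU 0))
  have hpN : 7 * p ≤ 7 * (T + 1) * p :=
    Nat.mul_le_mul_right p (Nat.le_mul_of_pos_right 7 T.succ_pos)
  have hD₀ : (fun _ => 1 / 2) ∈ GAN.discriminatorNets 𝒜 (k + 1) (7 * (T + 1) * p) d :=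
    GAN.half_mem_discriminatorNets hrelu (by omega)
  have hG₀m := GAN.measurable_of_mem_generatorNets h𝒜 hG₀
  refine ⟨7 * (T + 1) * p, GAN.natCast_sample_params_le hε hεΔ hΛ hp,
    fun u hu => GAN.ignoreFirst_mem_generatorNets hrelu (hG u hu) hp (by omega),
    fun v hv => GAN.mem_discriminatorNets_succ hrelu (hD v hv) (by omega),
    G₀, hG₀, fun _ => 1 / 2, hD₀, hG₀, mem_insert _ _, ?_, fun G' hG' => ?_⟩
  · rintro D' (rfl | ⟨v, hv, rfl⟩)
    · rw [GAN.payoff_half φ μ hG₀m]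
      linarith
    have hmean : ∀ i, ∫ h, φ (1 - D v (G (u i) h)) ∂(stdGaussian (EuclideanSpace ℝ (Fin l))) ≤
        φ (1 - D v (x i)) + ε / 8 := by
      intro i
      refine (GAN.integral_comp_le_of_lipschitz (hGL' _ (huU i)) (hfL v hv) (x i)).trans ?_
      have h := mul_le_mul_of_nonneg_left (hu i) (Lφ * L').coe_nonneg
      have heq : ((Lφ * L' : NNReal) : ℝ) * (ε / (8 * (Lφ * L'))) = ε / 8 := by
        push_cast
        field_simp
      rw [heq] at h
      linarith
    -- Errors: `ε / 2` from sampling, `ε / 8` from replacing points by generators, `ε / 8` from the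
    -- mixture.
    have hgen : ∫ h, φ (1 - D v (G₀ h)) ∂(stdGaussian (EuclideanSpace ℝ (Fin (l + 1)))) ≤
        ∫ y, φ (1 - D v y) ∂μ + ε := by
      refine (hG₀f _ (hfm v hv) (hfΔ v hv)).trans ?_
      have hT0 : (0 : ℝ) < (T + 1 : ℕ) := by positivity
      have h1 : ∑ i, ∫ h, φ (1 - D v (G (u i) h)) ∂(stdGaussian (EuclideanSpace ℝ (Fin l))) ≤
          (T + 1 : ℕ) * (∫ y, φ (1 - D v y) ∂μ + ε / 2 + ε / 8) := by
        refine (Finset.sum_le_sum fun i _ => hmean i).trans ?_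
        have := hx v hv
        simp only [Finset.sum_add_distrib, Finset.sum_const, Finset.card_univ, Fintype.card_fin,
          nsmul_eq_mul]
        linarith
      have h2 := mul_le_mul_of_nonneg_left h1 (one_div_pos.2 hT0).le
      rw [← mul_assoc, one_div_mul_cancel hT0.ne', one_mul] at h2
      linarith
    have hDm : Measurable fun y => φ (D v y) := by
      have hc : ContinuousOn φ (Icc 0 1) := hφL.continuousOn
      exact (hc.comp_continuous (hDL' v hv).continuous (hD v hv).2).measurable
    have hsum : ∫ y, φ (D v y) ∂μ + ∫ y, φ (1 - D v y) ∂μ ≤ 2 * φ (1 / 2) := by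
      have hi1 : Integrable (fun y => φ (D v y)) μ :=
        Integrable.of_mem_Icc _ _ hDm.aemeasurable (ae_of_all _ fun y => hφΔ _ ((hD v hv).2 y))
      have hi2 : Integrable (fun y => φ (1 - D v y)) μ :=
        Integrable.of_mem_Icc _ _ (hfm v hv).aemeasurable (ae_of_all _ (hfΔ v hv))
      rw [← integral_add hi1 hi2]
      have h := integral_mono (hi1.add hi2) (integrable_const (2 * φ (1 / 2))) fun y =>
        GAN.concaveOn_add_one_sub_le hφc ((hD v hv).2 y)
      simpa using h
    rw [GAN.payoff, GAN.generatedLaw,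
      integral_map (f := fun y => φ (1 - D v y)) hG₀m.aemeasurable
        (hfm v hv).aestronglyMeasurable]
    linarith
  · rw [GAN.payoff_half φ μ (GAN.measurable_of_mem_generatorNets h𝒜 hG')]
    linarith
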